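/- Let $G$ be a finite quiver (finite directed multigraph) with vertex set $V$ and edge set $E$, with source and target maps $s,t:E\to V$, and without self-loops ($s(e)\neq t(e)$ for every $e\in E$). Let $\underline n=(n_a)_{a\in V}$ be non-negative integers, let $\underline x=(x_e)_{e\in E}$ be complex numbers, and for every $e\in E$ let $U_e$ be a complex matrix of size $n_{s(e)}\times n_{t(e)}$. The twisted Laplacian is the endomorphism $\Delta$ of $\prod_{a\in V}\mathbb C^{n_a}$ given by $$(\Delta f)(a)=\sum_{e\in E:\ s(e)=a} x_e\big[f(s(e))-U_e f(t(e))\big],\qquad\text{and we put}\quad z_a=\sum_{e\in E:\ s(e)=a}x_e .$$ A cycle $c$ on $G$ is a sequence of edges $(e_1,\dots,e_k)$, $k\ge 1$, with $t(e_i)=s(e_{i+1})$ for $i<k$ and $t(e_k)=s(e_1)$, taken up to cyclic permutation; vertices and edges may be repeated. For such a cycle, $\mathrm{val}(c)$ is the order of the stabilizer of $(e_1,\dots,e_k)$ under the action of $\mathbb Z/k\mathbb Z$ by cyclic permutations, $v_a(c)=|\{i: s(e_i)=a\}|$ is its number of visits at the vertex $a$, $\underline e(c)\in\mathbb N^E$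 counts how many times it traverses each edge, $\underline x^{\underline e(c)}=x_{e_1}\cdots x_{e_k}$, and $\operatorname{Tr}\mathrm{hol}(c)=\operatorname{Tr}(U_{e_1}\cdots U_{e_k})$; none of these depends on the chosen starting edge. For a finite multiset $\mathsf C$ of cycles, $\mathsf C!$ is the product of the factorials of its multiplicities, and $\underline v(\mathsf C)=\sum_{c\in\mathsf C}\underline v(c)$, $\underline e(\mathsf C)=\sum_{c\in\mathsf C}\underline e(c)$. Sums and products over $c\in\mathsf C$ take multiplicities into account, inequalities between vectors are componentwise, $\underline y^{\underline m}=\prod_i y_i^{m_i}$ with $0^0=1$, and the empty multiset is allowed (empty products equal $1$). Then, for all $\underline t=(t_a)_{a\in V}\in\mathbb C^V$, with $T=\mathrm{diag}(t_aI_{n_a}:a\in V)$, $$\det(T+\Delta)=\sum_{\underline 0\le\underline k\le\underline n}\underline t^{\underline k}\sum_{\mathsf C:\ \underline v(\mathsf C)+\underline k\le\underline n}\ \prod_{a\in V}\binom{n_a-v_a(\mathsf C)}{k_a}\ \frac{\underline z^{\underline n-\underline k-\underline v(\mathsf C)}}{\mathsf C!}\ \underline x^{\underline e(\mathsf C)}\prod_{c\in\mathsf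 C}\frac{-\operatorname{Tr}\mathrm{hol}(c)}{\mathrm{val}(c)},$$ and in particular $$\det\Delta=\sum_{\mathsf C:\ \underline v(\mathsf C)\le\underline n}\frac{\underline z^{\underline n-\underline v(\mathsf C)}}{\mathsf C!}\prod_{c\in\mathsf C}\frac{-\underline x^{\underline e(c)}\operatorname{Tr}\mathrm{hol}(c)}{\mathrm{val}(c)},$$ where $\mathsf C$ runs over the (finitely many) multisets of cycles on $G$ satisfying the indicated constraint. -/

import Mathlib

open scoped Matrix BigOperators

namespace QuiverRep

section Paths

universe u w

/-- An edge of the quiver `V`: a source `a`, a target `b`, and one of the arrows `a ⟶ b`. -/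
abbrev Edge (V : Type u) [Quiver.{w} V] := Σ a b : V, (a ⟶ b)

/-- The source of an edge. -/
abbrev Edge.src {V : Type u} [Quiver.{w} V] (e : Edge V) : V := e.1

/-- The target of an edge. -/
abbrev Edge.tgt {V : Type u} [Quiver.{w} V] (e : Edge V) : V := e.2.1

variable {V : Type u} [Quiver.{w} V]

/-- The list `[e₁, …, e_k]` of edges traversed by a path, in order. -/
def edges {a : V} : {b : V} → Quiver.Path a b → List (Edge V)
  | _, .nil => []
  | _, .cons p e => edges p ++ [⟨_, _, e⟩]

theorem edges_comp {a b : V} (p : Quiver.Path a b) :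
    ∀ {c : V} (q : Quiver.Path b c), edges (p.comp q) = edges p ++ edges q
  | _, .nil => by simp [edges]
  | _, .cons q e => by simp [edges, edges_comp p q]

theorem length_edges {a : V} : ∀ {b : V} (p : Quiver.Path a b), (edges p).length = p.length
  | _, .nil => rfl
  | _, .cons p e => by simp [edges, length_edges p]

/-- Two paths, one of them non-trivial, with the same edges are the same path. -/
theorem path_eq_of_edges_eq {a b : V} (p : Quiver.Path a b) :
    ∀ {a' b' : V} (q : Quiver.Path a' b'), edges p ≠ [] → edges p = edges q →
      (⟨a, b, p⟩ : Σ a b : V, Quiver.Path a b) = ⟨a', b', q⟩ := by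
  induction p with
  | nil => intro a' b' q h; exact absurd rfl h
  | cons p e ih =>
    intro a' b' q _ h
    cases q with
    | nil => simp [edges] at h
    | cons q f =>
      simp only [edges] at h
      obtain ⟨h1, h2⟩ := List.append_inj' h rfl
      simp only [List.cons.injEq, and_true] at h2
      cases h2
      by_cases hp : edges p = []
      · have hq : edges q = [] := h1 ▸ hp
        have lp : p.length = 0 := by rw [← length_edges, hp]; rfl
        have lq : q.length = 0 := by rw [← length_edges, hq]; rfl
        cases p with
        | nil =>
          cases q with
          | nil => rfl
          | cons q g => simp at lq
        | cons p g => simp at lp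
      · cases ih q hp h1
        rfl

/-- Splitting the list of edges of a path splits the path. -/
theorem exists_comp_of_edges_eq_append {a b : V} (p : Quiver.Path a b) (l₁ l₂ : List (Edge V))
    (h : edges p = l₁ ++ l₂) :
    ∃ (c : V) (r : Quiver.Path a c) (s : Quiver.Path c b),
      p = r.comp s ∧ edges r = l₁ ∧ edges s = l₂ := by
  have hl : l₁.length ≤ p.length := by rw [← length_edges, h]; simp
  obtain ⟨c, r, s, hp, hr⟩ := p.exists_eq_comp_of_le_length hl
  subst hp
  rw [edges_comp] at h
  obtain ⟨h1, h2⟩ := List.append_inj h (by rw [length_edges, hr])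
  exact ⟨c, r, s, rfl, h1, h2⟩

/-- A closed path of positive length, with its base point. -/
abbrev ClosedPath (V : Type u) [Quiver.{w} V] := {p : Σ a : V, Quiver.Path a a // 0 < p.2.length}

/-- The edges traversed by a closed path, starting from its base point. -/
def ClosedPath.edges (p : ClosedPath V) : List (Edge V) := QuiverRep.edges p.1.2

/-- Two closed paths are equivalent when their edge sequences differ by a cyclic permutation. -/
instance closedPathSetoid (V : Type u) [Quiver.{w} V] : Setoid (ClosedPath V) where
  r p q := p.edges ~r q.edges
  iseqv := ⟨fun _ => List.IsRotated.refl _, fun h => h.symm, fun h h' => h.trans h'⟩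

/-- A cycle on the quiver: a well-chained closed sequence of edges, of positive length,
up to cyclic permutation. A vertex or an edge may be visited several times. -/
def Cyc (V : Type u) [Quiver.{w} V] := Quotient (closedPathSetoid V)

end Paths

section Cycles

universe u w

variable {V : Type u} [Quiver.{w} V]

/-- The number of elements of `ℤ / k ℤ` that fix a list of length `k`, for the action by cyclic
permutations. -/
noncomputable def numRotationsFixing {α : Type*} (l : List α) : ℕ := by
  classical
  exact ((Finset.range l.length).filter fun i => l.rotate i = l).card

theorem numRotationsFixing_eq {α : Type*} {l l' : List α} (h : l ~r l') :
    numRotationsFixing l = numRotationsFixing l' := by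
  classical
  obtain ⟨m, rfl⟩ := h
  simp only [numRotationsFixing, List.length_rotate]
  refine congrArg Finset.card (Finset.filter_congr fun i _ => ?_)
  rw [List.rotate_rotate, Nat.add_comm, ← List.rotate_rotate, List.rotate_eq_rotate]

/-- The valuation `val(c)` of a cycle: the order of the stabilizer of its sequence of edges under
cyclic permutations. -/
noncomputable def Cyc.val (c : Cyc V) : ℕ :=
  Quotient.lift (fun p : ClosedPath V => numRotationsFixing p.edges)
    (fun _ _ h => numRotationsFixing_eq h) c

/-- The vector `v(c)`: the number of visits of the cycle `c` at each vertex. -/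
def Cyc.visits [DecidableEq V] (c : Cyc V) : V → ℕ :=
  Quotient.lift (fun (p : ClosedPath V) (a : V) => (p.edges.map Edge.src).count a)
    (fun p q (h : p.edges ~r q.edges) => funext fun a => (h.perm.map Edge.src).count_eq a) c

open Classical in
/-- The vector `e(c)`: the number of times the cycle `c` traverses each edge. -/
noncomputable def Cyc.edgeCount (c : Cyc V) : Edge V → ℕ :=
  Quotient.lift (fun (p : ClosedPath V) (e : Edge V) => p.edges.count e)
    (fun p q (h : p.edges ~r q.edges) => funext fun e => h.perm.count_eq e) c

/-- The product `x_{e₁} ⋯ x_{e_k}` of the weights of the edges traversed by a cycle. -/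
def Cyc.weight (x : Edge V → ℂ) (c : Cyc V) : ℂ :=
  Quotient.lift (fun p : ClosedPath V => (p.edges.map x).prod)
    (fun p q (h : p.edges ~r q.edges) => (h.perm.map x).prod_eq) c

/-- The holonomy `U_{e₁} ⋯ U_{e_k}` along a path. -/
def hol {n : V → ℕ} (U : ∀ e : Edge V, Matrix (Fin (n e.src)) (Fin (n e.tgt)) ℂ) {a : V} :
    {b : V} → Quiver.Path a b → Matrix (Fin (n a)) (Fin (n b)) ℂ
  | _, .nil => 1
  | _, .cons p e => hol U p * U ⟨_, _, e⟩

theorem hol_comp {n : V → ℕ} (U : ∀ e : Edge V, Matrix (Fin (n e.src)) (Fin (n e.tgt)) ℂ)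
    {a b : V} (p : Quiver.Path a b) :
    ∀ {c : V} (q : Quiver.Path b c), hol U (p.comp q) = hol U p * hol U q
  | _, .nil => by simp [hol]
  | _, .cons q e => by simp [hol, hol_comp U p q, Matrix.mul_assoc]

/-- The trace of the holonomy of a closed path does not depend on the base point. -/
theorem trace_hol_eq {n : V → ℕ}
    (U : ∀ e : Edge V, Matrix (Fin (n e.src)) (Fin (n e.tgt)) ℂ)
    (p q : ClosedPath V) (h : p.edges ~r q.edges) :
    (hol U p.1.2).trace = (hol U q.1.2).trace := by
  obtain ⟨⟨a, p⟩, hp⟩ := p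
  obtain ⟨⟨b, q⟩, hq⟩ := q
  obtain ⟨m, hm⟩ := h
  simp only [ClosedPath.edges] at hm hp hq ⊢
  rw [List.rotate_eq_drop_append_take_mod] at hm
  obtain ⟨c, r, s, rfl, hr, hs⟩ := exists_comp_of_edges_eq_append p _ _
    (List.take_append_drop (m % (edges p).length) (edges p)).symm
  have hq' : edges q = edges (s.comp r) := by rw [edges_comp, hr, hs, hm]
  have hne : edges q ≠ [] := by
    intro h0
    rw [← length_edges, h0] at hq
    simp at hq
  cases path_eq_of_edges_eq q (s.comp r) hne hq'
  rw [hol_comp, hol_comp, Matrix.trace_mul_comm]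

/-- `Tr hol(c)`, the trace of the holonomy along a cycle. -/
def Cyc.traceHol {n : V → ℕ} (U : ∀ e : Edge V, Matrix (Fin (n e.src)) (Fin (n e.tgt)) ℂ)
    (c : Cyc V) : ℂ :=
  Quotient.lift (fun p : ClosedPath V => (hol U p.1.2).trace) (fun p q h => trace_hol_eq U p q h) c

/-- The vector `v(C)` of total numbers of visits of a multiset of cycles at the vertices. -/
def visits [DecidableEq V] (C : Multiset (Cyc V)) : V → ℕ := (C.map Cyc.visits).sum

/-- The vector `e(C)` of total numbers of traversals of the edges by a multiset of cycles. -/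
noncomputable def edgeCount (C : Multiset (Cyc V)) : Edge V → ℕ := (C.map Cyc.edgeCount).sum

open Classical in
/-- `C!`, the product of the factorials of the multiplicities of the elements of `C`. -/
noncomputable def multFactorial (C : Multiset (Cyc V)) : ℕ := ∏ c ∈ C.toFinset, (C.count c).factorial

/-- The edge sequence of a cycle, as a cyclically ordered list. -/
def Cyc.toCycle (c : Cyc V) : Cycle (Edge V) :=
  Quotient.lift (fun p : ClosedPath V => (p.edges : Cycle (Edge V)))
    (fun _ _ h => Quotient.sound h) c

theorem Cyc.toCycle_injective : Function.Injective (Cyc.toCycle (V := V)) := by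
  intro c d
  refine Quotient.inductionOn₂ c d fun p q h => ?_
  exact Quotient.sound (show p.edges ~r q.edges from Quotient.exact h)

theorem Cyc.sum_visits [Fintype V] [DecidableEq V] (c : Cyc V) :
    ∑ a, c.visits a = c.toCycle.length := by
  refine Quotient.inductionOn c fun p => ?_
  change ∑ a, (p.edges.map Edge.src).count a = p.edges.length
  have := Multiset.sum_count_eq_card (s := Finset.univ)
    (m := ((p.edges.map Edge.src : List V) : Multiset V)) (fun a _ => Finset.mem_univ a)
  simpa using this

theorem Cyc.length_pos (c : Cyc V) : 0 < c.toCycle.length := by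
  refine Quotient.inductionOn c fun p => ?_
  change 0 < (QuiverRep.edges p.1.2).length
  rw [length_edges]
  exact p.2

theorem sum_visits [Fintype V] [DecidableEq V] (C : Multiset (Cyc V)) :
    ∑ a, visits C a = (C.map fun c => c.toCycle.length).sum := by
  induction C using Multiset.induction_on with
  | empty => simp [visits]
  | cons c C ih =>
    have : visits (c ::ₘ C) = c.visits + visits C := by simp [visits]
    simp [this, Finset.sum_add_distrib, ih, Cyc.sum_visits]

theorem finite_multicycles [Fintype V] [DecidableEq V] [∀ a b : V, Fintype (a ⟶ b)] (n : V → ℕ) :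
    {C : Multiset (Cyc V) | visits C ≤ n}.Finite := by
  classical
  set N := ∑ a, n a
  have hfin : {c : Cyc V | c.toCycle.length ≤ N}.Finite := by
    refine Set.Finite.of_finite_image (f := Cyc.toCycle) ?_ Cyc.toCycle_injective.injOn
    refine ((List.finite_length_le (Edge V) N).image
      (fun l : List (Edge V) => (l : Cycle (Edge V)))).subset ?_
    rintro _ ⟨c, hc, rfl⟩
    revert hc
    refine Quotient.inductionOn c fun p hp => ?_
    exact ⟨p.edges, hp, rfl⟩
  refine (Set.finite_Iic (N • hfin.toFinset.val)).subset fun C hC => ?_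
  have hle : (C.map fun c => c.toCycle.length).sum ≤ N := by
    rw [← sum_visits]
    exact Finset.sum_le_sum fun a _ => hC a
  have hmem : ∀ c ∈ C, c.toCycle.length ≤ N := fun c hc =>
    le_trans (Multiset.single_le_sum (fun _ _ => Nat.zero_le _) _
      (Multiset.mem_map_of_mem (fun c : Cyc V => c.toCycle.length) hc)) hle
  have hcard : C.card ≤ N := by
    refine le_trans ?_ hle
    have := Multiset.card_nsmul_le_sum (s := C.map fun c => c.toCycle.length) (a := 1) (by
      intro k hk
      obtain ⟨c, _, rfl⟩ := Multiset.mem_map.1 hk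
      exact c.length_pos)
    simpa using this
  refine Multiset.le_iff_count.2 fun c => ?_
  by_cases hc : c ∈ C
  · have h1 : hfin.toFinset.val.count c = 1 :=
      Multiset.count_eq_one_of_mem hfin.toFinset.nodup (by simpa using hmem c hc)
    rw [Multiset.count_nsmul, h1]
    simpa using (Multiset.count_le_card c C).trans hcard
  · rw [Multiset.count_eq_zero_of_notMem hc]
    exact Nat.zero_le _

/-- The finite set of the multisets `C` of cycles with `v(C) ≤ n`: those which visit each vertex
`a` at most `n a` times in total. -/
noncomputable def multicycles [Fintype V] [DecidableEq V] [∀ a b : V, Fintype (a ⟶ b)]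
    (n : V → ℕ) : Finset (Multiset (Cyc V)) :=
  (finite_multicycles n).toFinset

end Cycles

section Laplacian

universe u w

variable {V : Type u} [Quiver.{w} V] [Fintype V] [∀ a b : V, Fintype (a ⟶ b)]

/-- `z_a`, the sum of the weights of the edges with source `a`. -/
def outWeight (x : Edge V → ℂ) (a : V) : ℂ := ∑ b, ∑ e : a ⟶ b, x ⟨a, b, e⟩

/-- The twisted Laplacian, an endomorphism of `∏ v, ℂ^{n v}`:
`(Δ f)(v) = ∑_{e : s(e) = v} x_e (f(s(e)) - U_e f(t(e)))`. -/
def laplacian {n : V → ℕ} (x : Edge V → ℂ)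
    (U : ∀ e : Edge V, Matrix (Fin (n e.src)) (Fin (n e.tgt)) ℂ) :
    (∀ v, Fin (n v) → ℂ) →ₗ[ℂ] (∀ v, Fin (n v) → ℂ) where
  toFun f v := ∑ b, ∑ e : v ⟶ b, x ⟨v, b, e⟩ • (f v - U ⟨v, b, e⟩ *ᵥ f b)
  map_add' f g := by
    funext v
    simp only [Pi.add_apply, Matrix.mulVec_add, ← Finset.sum_add_distrib, ← smul_add]
    refine Finset.sum_congr rfl fun b _ => Finset.sum_congr rfl fun e _ => ?_
    congr 1
    abel
  map_smul' r f := by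
    funext v
    simp only [Pi.smul_apply, Matrix.mulVec_smul, Finset.smul_sum, RingHom.id_apply,
      ← smul_sub]
    refine Finset.sum_congr rfl fun b _ => Finset.sum_congr rfl fun e _ => ?_
    rw [smul_comm]

/-- The endomorphism `T = diag(t_u I_{n_u} : u ∈ V)`. -/
def scalarDiag {V : Type u} (n : V → ℕ) (t : V → ℂ) :
    (∀ v, Fin (n v) → ℂ) →ₗ[ℂ] (∀ v, Fin (n v) → ℂ) where
  toFun f v := t v • f v
  map_add' f g := by funext v; simp
  map_smul' r f := by funext v; simp [smul_smul, mul_comm]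

end Laplacian

end QuiverRep

/-! With w_a = t_a + z_a, the matrix of T + Δ is diag(w) - B, where the (a, b) block of B is the sum
of the x_e U_e over the edges from a to b. Mark the rows of B at each vertex a by a variable y_a.
The trace of the k-th power of the marked matrix sums over based closed paths of length k; a cycle c
of length k has k / val(c) base points, so this trace is -k times the sum of the factors -x^e(c) Tr
hol(c) / val(c), marked by y^v(c). Formally, det(1 - sB) = exp(-∑ s^k Tr(B^k) / k) is thus the
exponential of a sum over cycles, that is, a sum over multisets with weights 1 / C!.

Exponentials are avoided: the coefficients of det(1 - sB) obey Newton's identities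
(`Matrix.coeff_charpolyRev_succ`), and so do the sums over multisets of total length k
(`sum_multicycleTerm_succ`), by marking one cycle. This determines both.

Those sums are infinite over all k, but det(1 - B) has degree at most n_a in y_a, so only multisets
with v(C) ≤ n survive. Setting y_a = 1 / w_a and multiplying by w^n gives the formula for invertible
w, density gives all w, and the binomial theorem applied to (t_a + z_a)^(n_a - v_a(C)) ends the
proof. -/

namespace Matrix

/-! ### Newton's identities for det(1 - sB) -/

open Polynomial

variable {ι R : Type*} [Fintype ι] [DecidableEq ι] [CommRing R]

/-- Jacobi's formula for the derivative of the determinant of a matrix of polynomials. -/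
theorem derivative_det_eq_trace_adjugate (M : Matrix ι ι R[X]) :
    derivative M.det = (M.adjugate * M.map derivative).trace := by
  -- By Cramer's rule, each diagonal entry is the determinant with one column differentiated.
  have h1 : (M.adjugate * M.map derivative).trace =
      ∑ i, (M.updateCol i fun k => derivative (M k i)).det := by
    refine Finset.sum_congr rfl fun i _ => ?_
    rw [← cramer_apply, cramer_eq_adjugate_mulVec]
    rfl
  rw [h1, det_apply', derivative_sum]
  simp_rw [det_apply']
  rw [Finset.sum_comm]
  refine Finset.sum_congr rfl fun σ _ => ?_
  rw [derivative_intCast_mul, derivative_prod_finset, Finset.mul_sum]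
  refine Finset.sum_congr rfl fun i _ => ?_
  congr 1
  rw [← Finset.mul_prod_erase _ _ (Finset.mem_univ i), mul_comm]
  simp only [updateCol_self]
  congr 1
  refine Finset.prod_congr rfl fun j hj => ?_
  rw [updateCol_ne (Finset.ne_of_mem_erase hj)]

/-- Newton's identities: a recursion for the coefficients of the reverse characteristic polynomial
in terms of traces of powers. -/
theorem coeff_charpolyRev_succ (B : Matrix ι ι R) (k : ℕ) :
    ((k : R) + 1) * B.charpolyRev.coeff (k + 1) =
      -∑ j ∈ Finset.range (k + 1), B.charpolyRev.coeff (k - j) * (B ^ (j + 1)).trace := by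
  set M : Matrix ι ι R[X] := 1 - (X : R[X]) • B.map (C : R →+* R[X]) with hM
  set N : ℕ → Matrix ι ι R := fun k => M.adjugate.map fun p : R[X] => p.coeff k with hN
  have hF : B.charpolyRev = M.det := rfl
  -- This is adj(M) M = det(M) with M = 1 - XB substituted; its coefficients give a recursion for
  -- those of adj(M), solved in `hNk`.
  have hadj : M.adjugate = (X : R[X]) • (M.adjugate * B.map (C : R →+* R[X])) + M.det • (1 : Matrix ι ι R[X]) := by
    rw [← adjugate_mul M]
    conv_rhs => rw [hM]
    rw [← hM, mul_sub, mul_one, Matrix.mul_smul]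
    abel
  have hmulC : ∀ k, (M.adjugate * B.map (C : R →+* R[X])).map (fun p : R[X] => p.coeff k) = N k * B := by
    intro k
    ext i j
    simp [Matrix.mul_apply, hN]
  have hone : ∀ k, (M.det • (1 : Matrix ι ι R[X])).map (fun p : R[X] => p.coeff k) =
      M.det.coeff k • (1 : Matrix ι ι R) := by
    intro k
    ext i j
    by_cases h : i = j <;> simp [h]
  have h0 : N 0 = M.det.coeff 0 • (1 : Matrix ι ι R) := by
    rw [← hone 0]
    ext i j
    have := congrArg (fun p : R[X] => p.coeff 0) (congrFun (congrFun hadj i) j)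
    simpa [hN] using this
  have hsucc : ∀ k, N (k + 1) = N k * B + M.det.coeff (k + 1) • (1 : Matrix ι ι R) := by
    intro k
    rw [← hone, ← hmulC]
    ext i j
    have := congrArg (fun p : R[X] => p.coeff (k + 1)) (congrFun (congrFun hadj i) j)
    simpa [hN] using this
  have hNk : ∀ k, N k = ∑ j ∈ Finset.range (k + 1), M.det.coeff (k - j) • B ^ j := by
    intro k
    induction k with
    | zero => simp [h0]
    | succ k ih =>
      rw [hsucc, ih, Finset.sum_range_succ' _ (k + 1), Finset.sum_mul]
      simp [pow_succ]
  have hder : M.map derivative = -B.map (C : R →+* R[X]) := by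
    ext i j : 2
    by_cases h : i = j <;> simp [hM, h]
  have hJ := congrArg (fun p : R[X] => p.coeff k) (derivative_det_eq_trace_adjugate M)
  simp only [coeff_derivative, hder, Matrix.mul_neg, trace_neg, coeff_neg] at hJ
  have htr : (M.adjugate * B.map (C : R →+* R[X])).trace.coeff k = (N k * B).trace := by
    rw [← hmulC]
    simp [trace]
  rw [hF, mul_comm, hJ, htr, hNk, Finset.sum_mul, trace_sum]
  simp [pow_succ]

end Matrix

/-! ### Degree bound for determinants -/

namespace MvPolynomial

variable {ι σ R : Type*} [Fintype ι] [DecidableEq ι] [CommRing R]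

/-- The degree of a determinant in a variable is at most the sum of the degrees of the rows. -/
theorem degreeOf_det_le (M : Matrix ι ι (MvPolynomial σ R)) (a : σ) (d : ι → ℕ)
    (h : ∀ i j, degreeOf a (M i j) ≤ d i) : degreeOf a M.det ≤ ∑ i, d i := by
  rw [Matrix.det_apply']
  refine (degreeOf_sum_le _ _ _).trans (Finset.sup_le fun σ _ => ?_)
  refine (degreeOf_mul_le _ _ _).trans ?_
  have h0 : degreeOf a (((Equiv.Perm.sign σ : ℤ) : MvPolynomial _ R)) = 0 := by
    rw [← map_intCast (C : R →+* MvPolynomial _ R), degreeOf_C]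
  rw [h0, zero_add]
  refine (degreeOf_prod_le _ _ _).trans ?_
  -- The i-th factor of a Leibniz term lies in row `σ i`, so the row bounds are reindexed by `σ`.
  rw [← Equiv.sum_comp σ d]
  exact Finset.sum_le_sum fun i _ => h _ _

end MvPolynomial

/-! ### Rotations of lists and base points of cycles -/

namespace QuiverRep

section Rotations

variable {α : Type*}

theorem cyclicPermutations_eq_map_rotate {l : List α} (hl : l ≠ []) :
    l.cyclicPermutations = (List.range l.length).map l.rotate := by
  refine List.ext_getElem (by simp [List.length_cyclicPermutations_of_ne_nil l hl]) ?_
  intro i h1 h2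
  simp [List.getElem_cyclicPermutations]

theorem numRotationsFixing_eq_count [DecidableEq α] {l : List α} (hl : l ≠ []) :
    numRotationsFixing l = (l.cyclicPermutations : Multiset (List α)).count l := by
  have h : numRotationsFixing l =
      ((Finset.range l.length).filter fun i => l.rotate i = l).card := by
    rw [numRotationsFixing]
    -- The two sides differ only in their decidability instances.
    congr!
  rw [h, cyclicPermutations_eq_map_rotate hl, Multiset.count, ← Multiset.map_coe,
    Multiset.countP_map, Finset.card_def, Finset.filter_val]
  refine congrArg Multiset.card (Multiset.filter_congr fun i _ => ?_)
  exact eq_comm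

/-- The orbit of a list under rotations, times the order of the stabilizer, is its length. -/
theorem card_cyclicPermutations_mul_numRotationsFixing [DecidableEq α] {l : List α}
    (hl : l ≠ []) :
    l.cyclicPermutations.toFinset.card * numRotationsFixing l = l.length := by
  -- Among the `l.length` rotations counted with repetition, each distinct one occurs as often as
  -- the stabilizer has elements.
  have h1 := Multiset.toFinset_sum_count_eq (l.cyclicPermutations : Multiset (List α))
  rw [Multiset.coe_card, List.length_cyclicPermutations_of_ne_nil l hl] at h1
  rw [← h1, ← smul_eq_mul]
  refine (Finset.sum_const _).symm.trans (Finset.sum_congr rfl fun l' hl' => ?_)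
  have hr : l' ~r l := List.mem_cyclicPermutations_iff.1 (by simpa using hl')
  have hl'0 : l' ≠ [] := by
    rintro rfl
    exact hl (List.isRotated_nil_iff'.1 hr).symm
  rw [← Multiset.coe_eq_coe.2 hr.cyclicPermutations.perm,
    ← numRotationsFixing_eq_count hl'0, numRotationsFixing_eq hr]

end Rotations

section Cycles

universe u w

variable {V : Type u} [Quiver.{w} V]

theorem ClosedPath.edges_ne_nil (p : ClosedPath V) : p.edges ≠ [] := by
  intro h
  have := p.2
  rw [← length_edges] at this
  rw [ClosedPath.edges] at h
  simp [h] at this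

theorem ClosedPath.edges_injective : Function.Injective (ClosedPath.edges (V := V)) := by
  intro p q h
  have hp := p.edges_ne_nil
  obtain ⟨⟨a, p⟩, _⟩ := p
  obtain ⟨⟨b, q⟩, _⟩ := q
  cases path_eq_of_edges_eq p q hp h
  rfl

/-- Cut the path where the rotation starts and swap the two pieces: closedness makes them composable
in the other order. -/
theorem ClosedPath.exists_edges_eq_of_isRotated (p : ClosedPath V) {l : List (Edge V)}
    (h : p.edges ~r l) : ∃ q : ClosedPath V, q.edges = l := by
  obtain ⟨⟨a, p⟩, hp⟩ := p
  obtain ⟨m, hm⟩ := h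
  simp only [ClosedPath.edges] at hm hp ⊢
  rw [List.rotate_eq_drop_append_take_mod] at hm
  obtain ⟨c, r, s, rfl, hr, hs⟩ := exists_comp_of_edges_eq_append p _ _
    (List.take_append_drop (m % (QuiverRep.edges p).length) (QuiverRep.edges p)).symm
  refine ⟨⟨⟨c, s.comp r⟩, ?_⟩, ?_⟩
  · simpa [Quiver.Path.length_comp, add_comm] using hp
  · simp only
    rw [edges_comp, hr, hs, hm]

/-- The cycle represented by a closed path. -/
def ClosedPath.toCyc (p : ClosedPath V) : Cyc V := Quotient.mk _ p

/-- The number of closed paths representing a cycle, times its valuation, is its length. -/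
theorem Cyc.card_mul_val (c : Cyc V) (S : Finset (ClosedPath V))
    (hS : ∀ p, p ∈ S ↔ p.toCyc = c) :
    S.card * c.val = c.toCycle.length := by
  classical
  induction c using Quotient.inductionOn with | h p
  change S.card * numRotationsFixing p.edges = p.edges.length
  rw [← card_cyclicPermutations_mul_numRotationsFixing p.edges_ne_nil,
    ← Finset.card_image_of_injective S ClosedPath.edges_injective]
  congr 2
  ext l
  simp only [Finset.mem_image, hS, List.mem_toFinset, List.mem_cyclicPermutations_iff]
  constructor
  · rintro ⟨q, hq, rfl⟩
    exact Quotient.exact hq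
  · intro h
    obtain ⟨q, rfl⟩ := p.exists_edges_eq_of_isRotated h.symm
    exact ⟨q, Quotient.sound h, rfl⟩

theorem visits_cons [DecidableEq V] (c : Cyc V) (C : Multiset (Cyc V)) :
    visits (c ::ₘ C) = c.visits + visits C := by simp [visits]

open Classical in
theorem multFactorial_cons (c : Cyc V) (C : Multiset (Cyc V)) :
    multFactorial (c ::ₘ C) = (C.count c + 1) * multFactorial C := by
  -- Both products are taken over one common support; the extra factors are 0! = 1.
  have h : ∀ D : Multiset (Cyc V), D ≤ c ::ₘ C →
      multFactorial D = ∏ d ∈ (c ::ₘ C).toFinset, (D.count d).factorial := by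
    intro D hD
    refine Finset.prod_subset (Multiset.toFinset_subset.2 (Multiset.subset_of_le hD)) ?_
    intro d _ hd
    rw [Multiset.count_eq_zero_of_notMem (by simpa using hd), Nat.factorial_zero]
  have hc : c ∈ (c ::ₘ C).toFinset := by simp
  rw [h _ le_rfl, h _ (Multiset.le_cons_self C c), ← Finset.mul_prod_erase _ _ hc,
    ← Finset.mul_prod_erase _ _ hc, Multiset.count_cons_self, Nat.factorial_succ, mul_assoc]
  congr 2
  refine Finset.prod_congr rfl fun d hd => ?_
  rw [Multiset.count_cons_of_ne (Finset.ne_of_mem_erase hd)]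

theorem multFactorial_ne_zero (C : Multiset (Cyc V)) : multFactorial C ≠ 0 :=
  Finset.prod_ne_zero_iff.2 fun _ _ => Nat.factorial_ne_zero _

theorem mem_multicycles [Fintype V] [DecidableEq V] [∀ a b : V, Fintype (a ⟶ b)] {n : V → ℕ}
    {C : Multiset (Cyc V)} : C ∈ multicycles n ↔ visits C ≤ n := by
  simp [multicycles]

theorem prod_pow_edgeCount [Fintype V] [∀ a b : V, Fintype (a ⟶ b)] (x : Edge V → ℂ)
    (C : Multiset (Cyc V)) :
    ∏ e : Edge V, x e ^ edgeCount C e = (C.map (Cyc.weight x)).prod := by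
  classical
  induction C using Multiset.induction_on with
  | empty => simp [edgeCount]
  | cons c C ih =>
    have : edgeCount (c ::ₘ C) = c.edgeCount + edgeCount C := by simp [edgeCount]
    simp only [this, Pi.add_apply, pow_add, Finset.prod_mul_distrib, ih, Multiset.map_cons,
      Multiset.prod_cons]
    congr 1
    induction c using Quotient.inductionOn with | h p
    have := Finset.prod_multiset_map_count (p.edges : Multiset (Edge V)) x
    rw [Multiset.map_coe, Multiset.prod_coe] at this
    refine Eq.trans ?_ this.symm
    refine (Finset.prod_subset_one_on_sdiff (Finset.subset_univ _) (fun e he => ?_)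
      fun e _ => ?_).symm
    · have h0 : Cyc.edgeCount ⟦p⟧ e = 0 := List.count_eq_zero_of_not_mem (by simpa using he)
      rw [h0, pow_zero]
    · rw [Multiset.coe_count]
      rfl

end Cycles

end QuiverRep

/-! ### Powers of the marked matrix as sums over paths -/

namespace QuiverRep

open MvPolynomial

universe u w

variable {V : Type u} [Quiver.{w} V]

/-- Appending an edge to a path, as an embedding. -/
def pathConsEmbedding (a b : V) :
    (Σ c : V, Quiver.Path a c × (c ⟶ b)) ↪ Quiver.Path a b where
  toFun p := p.2.1.cons p.2.2
  inj' := by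
    rintro ⟨c, p, e⟩ ⟨c', p', e'⟩ h
    cases h
    rfl

@[simp]
theorem pathConsEmbedding_apply {a b c : V} (p : Quiver.Path a c) (e : c ⟶ b) :
    pathConsEmbedding a b ⟨c, p, e⟩ = p.cons e := rfl

/-- The product of the weights of the edges of a path. -/
def pathWeight (x : Edge V → ℂ) {a b : V} (p : Quiver.Path a b) : ℂ := ((edges p).map x).prod

theorem pathWeight_cons (x : Edge V → ℂ) {a b c : V} (p : Quiver.Path a b) (e : b ⟶ c) :
    pathWeight x (p.cons e) = pathWeight x p * x ⟨b, c, e⟩ := by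
  simp [pathWeight, edges]

variable {n : V → ℕ} (x : Edge V → ℂ)
  (U : ∀ e : Edge V, Matrix (Fin (n e.src)) (Fin (n e.tgt)) ℂ)

/-- The contribution of a cycle to the expansion of the determinant. -/
noncomputable def Cyc.factor (c : Cyc V) : ℂ := -(c.weight x * c.traceHol U) / (c.val : ℂ)

variable [DecidableEq V]

/-- The number of visits of a path at each vertex, not counting its endpoint. -/
noncomputable def pathVisits {a b : V} (p : Quiver.Path a b) : V →₀ ℕ :=
  Multiset.toFinsupp (((edges p).map Edge.src : List V) : Multiset V)

/-- The new visit is at the source `b` of the appended edge, as endpoints do not count; this is why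
the marking variables are put on rows. -/
theorem pathVisits_cons {a b c : V} (p : Quiver.Path a b) (e : b ⟶ c) :
    pathVisits (p.cons e) = pathVisits p + Finsupp.single b 1 := by
  rw [pathVisits, edges, List.map_append, ← Multiset.coe_add, map_add]
  simp [pathVisits]

variable [Fintype V]

/-- The contribution of a multiset of cycles to the expansion of the determinant. -/
noncomputable def multicycleTerm (C : Multiset (Cyc V)) : MvPolynomial V ℂ :=
  monomial (Finsupp.equivFunOnFinite.symm (visits C))
    ((C.map (Cyc.factor x U)).prod / (multFactorial C : ℂ))

theorem coeff_multicycleTerm (C : Multiset (Cyc V)) (v : V →₀ ℕ) :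
    coeff v (multicycleTerm x U C) = if visits C = v then
      (C.map (Cyc.factor x U)).prod / (multFactorial C : ℂ) else 0 := by
  have : Finsupp.equivFunOnFinite.symm (visits C) = v ↔ visits C = v := by
    rw [Equiv.symm_apply_eq]
    rfl
  rw [multicycleTerm, coeff_monomial]
  simp only [this]

theorem sum_visits_cons (c : Cyc V) (C : Multiset (Cyc V)) :
    ∑ a, visits (c ::ₘ C) a = c.toCycle.length + ∑ a, visits C a := by
  rw [sum_visits, sum_visits, Multiset.map_cons, Multiset.sum_cons]

-- Adding `c` multiplies C! by the new multiplicity of `c`. Multiplying by that multiplicity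
-- therefore leaves a plain product, which drives the Newton recursion for multisets.
open Classical in
theorem multicycleTerm_cons (c : Cyc V) (C : Multiset (Cyc V)) :
    ((C.count c + 1 : ℕ) : MvPolynomial V ℂ) * multicycleTerm x U (c ::ₘ C) =
      monomial (Finsupp.equivFunOnFinite.symm c.visits) (c.factor x U) *
        multicycleTerm x U C := by
  have h : ((C.count c + 1 : ℕ) : MvPolynomial V ℂ) =
      MvPolynomial.C (((C.count c + 1 : ℕ) : ℂ)) := by simp
  rw [multicycleTerm, multicycleTerm, h, C_mul_monomial, monomial_mul, visits_cons,
    multFactorial_cons, Multiset.map_cons, Multiset.prod_cons]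
  have h1 : (((C.count c + 1 : ℕ)) : ℂ) ≠ 0 := Nat.cast_ne_zero.2 (Nat.succ_ne_zero _)
  have h2 : (multFactorial C : ℂ) ≠ 0 := Nat.cast_ne_zero.2 (multFactorial_ne_zero C)
  have hv : Finsupp.equivFunOnFinite.symm (c.visits + visits C) =
      Finsupp.equivFunOnFinite.symm c.visits + Finsupp.equivFunOnFinite.symm (visits C) := by
    ext a
    simp
  rw [hv]
  refine congrArg _ ?_
  · push_cast at h1 ⊢
    field_simp

variable [∀ a b : V, Fintype (a ⟶ b)]

/-- The finite set of the paths of given length between two vertices. -/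
def pathsOfLength (a : V) : ℕ → ∀ b : V, Finset (Quiver.Path a b)
  | 0, b => if h : a = b then {h ▸ Quiver.Path.nil} else ∅
  | k + 1, b => (Finset.univ.sigma fun c =>
      pathsOfLength a k c ×ˢ (Finset.univ : Finset (c ⟶ b))).map (pathConsEmbedding a b)

theorem mem_pathsOfLength {a : V} {k : ℕ} {b : V} {p : Quiver.Path a b} :
    p ∈ pathsOfLength a k b ↔ p.length = k := by
  induction k generalizing b with
  | zero =>
    constructor
    · intro h
      by_cases hab : a = b
      · subst hab
        simp only [pathsOfLength, dif_pos, Finset.mem_singleton] at h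
        rw [h]
        rfl
      · simp [pathsOfLength, hab] at h
    · intro h
      cases p with
      | nil => simp [pathsOfLength]
      | cons p e => simp at h
  | succ k ih =>
    simp only [pathsOfLength, Finset.mem_map, Finset.mem_sigma, Finset.mem_product,
      Finset.mem_univ, true_and, and_true]
    constructor
    · rintro ⟨⟨c, q, e⟩, hq, rfl⟩
      simp only [pathConsEmbedding_apply, Quiver.Path.length_cons, ih.1 hq]
    · intro h
      cases p with
      | nil => simp at h
      | cons q e => exact ⟨⟨_, q, e⟩, ih.2 (by simpa using h), rfl⟩

theorem sum_pathsOfLength_succ {M : Type*} [AddCommMonoid M] (a : V) (k : ℕ) (b : V)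
    (f : Quiver.Path a b → M) :
    ∑ p ∈ pathsOfLength a (k + 1) b, f p =
      ∑ c, ∑ p ∈ pathsOfLength a k c, ∑ e : c ⟶ b, f (p.cons e) := by
  simp [pathsOfLength, Finset.sum_map, Finset.sum_sigma, Finset.sum_product]

/-- The block matrix whose block at `(a, b)` is the sum of `x_e U_e` over the edges `e` from
`a` to `b`. -/
def blockMatrix :
    Matrix (Σ v, Fin (n v)) (Σ v, Fin (n v)) ℂ :=
  fun i j => ∑ e : i.1 ⟶ j.1, x ⟨i.1, j.1, e⟩ * U ⟨i.1, j.1, e⟩ i.2 j.2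

/-- The block matrix of the `x_e U_e`, with the rows at each vertex multiplied by a variable. -/
noncomputable def markedBlockMatrix :
    Matrix (Σ v, Fin (n v)) (Σ v, Fin (n v)) (MvPolynomial V ℂ) :=
  fun i j => monomial (Finsupp.single i.1 1) (blockMatrix x U i j)

theorem markedBlockMatrix_pow_apply (k : ℕ) (i j : Σ v, Fin (n v)) :
    (markedBlockMatrix x U ^ k) i j = ∑ p ∈ pathsOfLength i.1 k j.1,
      monomial (pathVisits p) (pathWeight x p * hol U p i.2 j.2) := by
  induction k generalizing j with
  | zero =>
    obtain ⟨a, i⟩ := i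
    obtain ⟨b, j⟩ := j
    by_cases hab : a = b
    · subst hab
      simp [pathsOfLength, Matrix.one_apply, pathVisits, pathWeight, edges, hol, apply_ite]
    · have : (⟨a, i⟩ : Σ v, Fin (n v)) ≠ ⟨b, j⟩ := fun h => hab (congrArg Sigma.fst h)
      simp [pathsOfLength, hab, Matrix.one_apply_ne this]
  | succ k ih =>
    rw [pow_succ, Matrix.mul_apply, sum_pathsOfLength_succ, Fintype.sum_sigma]
    refine Finset.sum_congr rfl fun c _ => ?_
    simp only [ih, Finset.sum_mul]
    rw [Finset.sum_comm]
    refine Finset.sum_congr rfl fun p _ => ?_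
    simp only [markedBlockMatrix, blockMatrix, monomial_mul, pathVisits_cons, pathWeight_cons,
      hol, Matrix.mul_apply]
    rw [← map_sum, ← map_sum]
    congr 1
    simp only [Finset.mul_sum]
    rw [Finset.sum_comm]
    refine Finset.sum_congr rfl fun e _ => Finset.sum_congr rfl fun m _ => ?_
    ring

theorem trace_markedBlockMatrix_pow (k : ℕ) :
    (markedBlockMatrix x U ^ k).trace = ∑ a, ∑ p ∈ pathsOfLength a k a,
      monomial (pathVisits p) (pathWeight x p * (hol U p).trace) := by
  simp only [Matrix.trace, Matrix.diag_apply, markedBlockMatrix_pow_apply, Fintype.sum_sigma]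
  refine Finset.sum_congr rfl fun a _ => ?_
  rw [Finset.sum_comm]
  refine Finset.sum_congr rfl fun p _ => ?_
  rw [← map_sum, Finset.mul_sum]

/-! ### From closed paths to cycles -/

variable (V) in
/-- The finite set of the closed paths of length `k + 1`. -/
noncomputable def closedPaths (k : ℕ) : Finset (ClosedPath V) :=
  (Finset.univ.sigma fun a : V => pathsOfLength a (k + 1) a).subtype _

theorem mem_closedPaths {k : ℕ} {p : ClosedPath V} :
    p ∈ closedPaths V k ↔ p.edges.length = k + 1 := by
  simp [closedPaths, mem_pathsOfLength, ClosedPath.edges, length_edges]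

theorem sum_closedPaths {M : Type*} [AddCommMonoid M] (k : ℕ)
    (f : (Σ a : V, Quiver.Path a a) → M) :
    ∑ p ∈ closedPaths V k, f p.1 = ∑ a, ∑ p ∈ pathsOfLength a (k + 1) a, f ⟨a, p⟩ := by
  rw [closedPaths, Finset.sum_subtype_of_mem, Finset.sum_sigma]
  rintro ⟨a, p⟩ hp
  have := mem_pathsOfLength.1 (Finset.mem_sigma.1 hp).2
  simp only at this ⊢
  omega

open Classical in
variable (V) in
/-- The finite set of the cycles of length `k + 1`. -/
noncomputable def cycles (k : ℕ) : Finset (Cyc V) := (closedPaths V k).image (ClosedPath.toCyc)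

theorem mem_cycles {k : ℕ} {c : Cyc V} : c ∈ cycles V k ↔ c.toCycle.length = k + 1 := by
  simp only [cycles, Finset.mem_image]
  induction c using Quotient.inductionOn with | h p
  constructor
  · rintro ⟨q, hq, h⟩
    rw [← h]
    exact mem_closedPaths.1 hq
  · intro h
    exact ⟨p, mem_closedPaths.2 h, rfl⟩

/-- The traces of powers of the marked block matrix as sums over cycles. -/
theorem sum_cycles_eq_neg_trace (k : ℕ) :
    ∑ c ∈ cycles V k, ((k : MvPolynomial V ℂ) + 1) *
      monomial (Finsupp.equivFunOnFinite.symm c.visits) (c.factor x U) =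
        -(markedBlockMatrix x U ^ (k + 1)).trace := by
  classical
  rw [trace_markedBlockMatrix_pow, ← sum_closedPaths (V := V) k (fun p =>
    monomial (pathVisits p.2) (pathWeight x p.2 * (hol U p.2).trace)), ← Finset.sum_neg_distrib]
  rw [← Finset.sum_fiberwise_of_maps_to (t := cycles V k) (g := ClosedPath.toCyc)
    (fun p hp => Finset.mem_image_of_mem _ hp)]
  refine Finset.sum_congr rfl fun c hc => ?_
  -- The fibre over `c` has (k + 1) / val(c) elements, all contributing the same monomial: hence
  -- val(c) in the denominator.
  have hcard := c.card_mul_val ((closedPaths V k).filter fun p => p.toCyc = c)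
    fun p => by
      rw [Finset.mem_filter, and_iff_right_iff_imp]
      rintro rfl
      exact mem_closedPaths.2 (mem_cycles.1 hc)
  rw [mem_cycles.1 hc] at hcard
  have hterm : ∀ p ∈ (closedPaths V k).filter fun p => p.toCyc = c,
      -monomial (pathVisits p.1.2) (pathWeight x p.1.2 * (hol U p.1.2).trace) =
      monomial (Finsupp.equivFunOnFinite.symm c.visits) (-(c.weight x * c.traceHol U)) := by
    intro p hp
    obtain ⟨_, rfl⟩ := Finset.mem_filter.1 hp
    rw [← map_neg]
    congr 2
    ext a
    simp only [pathVisits, Multiset.toFinsupp_apply, Multiset.coe_count]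
    rfl
  rw [Finset.sum_congr rfl hterm, Finset.sum_const, ← map_nsmul]
  have hk : (k : MvPolynomial V ℂ) + 1 = C ((k : ℂ) + 1) := by simp
  rw [hk, C_mul_monomial]
  congr 1
  have hcast : (((closedPaths V k).filter fun p => p.toCyc = c).card : ℂ) *
      c.val = k + 1 := by exact_mod_cast hcard
  have hval : (c.val : ℂ) ≠ 0 := by
    intro h
    rw [h, mul_zero] at hcast
    exact Nat.cast_add_one_ne_zero k hcast.symm
  rw [← hcast, Cyc.factor, nsmul_eq_mul]
  field_simp

/-! ### Newton's identities for multisets of cycles -/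

variable (V) in
/-- The finite set of the multisets of cycles of given total length. -/
noncomputable def multicyclesOfLength (k : ℕ) : Finset (Multiset (Cyc V)) :=
  -- The box only provides finiteness: a total of `k` bounds each coordinate by `k`.
  (multicycles fun _ => k).filter fun C => ∑ a, visits C a = k

theorem mem_multicyclesOfLength {k : ℕ} {C : Multiset (Cyc V)} :
    C ∈ multicyclesOfLength V k ↔ ∑ a, visits C a = k := by
  rw [multicyclesOfLength, Finset.mem_filter, and_iff_right_iff_imp, mem_multicycles]
  rintro rfl a
  exact Finset.single_le_sum (f := visits C) (fun _ _ => Nat.zero_le _) (Finset.mem_univ a)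

/-- The sums over multisets of cycles of given total length satisfy Newton's identities. -/
theorem sum_multicycleTerm_succ (k : ℕ) :
    ((k : MvPolynomial V ℂ) + 1) * ∑ C ∈ multicyclesOfLength V (k + 1), multicycleTerm x U C =
      -∑ j ∈ Finset.range (k + 1), (∑ C ∈ multicyclesOfLength V (k - j), multicycleTerm x U C) *
        (markedBlockMatrix x U ^ (j + 1)).trace := by
  classical
  -- The factor k + 1 is the total length, split as multiplicity times length over the distinct
  -- cycles of the multiset: this marks one of them.
  have hL : ((k : MvPolynomial V ℂ) + 1) *
      ∑ C ∈ multicyclesOfLength V (k + 1), multicycleTerm x U C =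
      ∑ C ∈ multicyclesOfLength V (k + 1), ∑ c ∈ C.toFinset,
        ((C.count c * c.toCycle.length : ℕ) : MvPolynomial V ℂ) * multicycleTerm x U C := by
    rw [Finset.mul_sum]
    refine Finset.sum_congr rfl fun C hC => ?_
    rw [← Finset.sum_mul, ← Nat.cast_sum]
    congr 1
    rw [mem_multicyclesOfLength, sum_visits, Finset.sum_multiset_map_count] at hC
    simp only [smul_eq_mul] at hC
    rw [hC]
    push_cast
    rfl
  have hR : ∀ j, -((∑ C ∈ multicyclesOfLength V (k - j), multicycleTerm x U C) *
        (markedBlockMatrix x U ^ (j + 1)).trace) =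
      ∑ q ∈ cycles V j ×ˢ multicyclesOfLength V (k - j), ((j : MvPolynomial V ℂ) + 1) *
        (monomial (Finsupp.equivFunOnFinite.symm q.1.visits) (q.1.factor x U) *
          multicycleTerm x U q.2) := by
    intro j
    rw [← mul_neg, ← sum_cycles_eq_neg_trace, mul_comm, Finset.sum_mul_sum, Finset.sum_product]
    simp only [mul_assoc]
  rw [hL, ← Finset.sum_neg_distrib]
  simp only [hR]
  rw [Finset.sum_sigma', Finset.sum_sigma']
  -- Removing one copy of the marked cycle, of length j + 1, leaves a multiset of total length k -
  -- j.
  refine Finset.sum_bij' (fun p _ => ⟨p.2.toCycle.length - 1, p.2, p.1.erase p.2⟩)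
    (fun q _ => ⟨q.2.1 ::ₘ q.2.2, q.2.1⟩) ?_ ?_ ?_ ?_ ?_
  · rintro ⟨C, c⟩ h
    simp only [Finset.mem_sigma, Multiset.mem_toFinset, mem_multicyclesOfLength] at h
    obtain ⟨hC, hc⟩ := h
    rw [← Multiset.cons_erase hc, sum_visits_cons] at hC
    have := c.length_pos
    simp only [Finset.mem_sigma, Finset.mem_range, Finset.mem_product, mem_cycles,
      mem_multicyclesOfLength]
    omega
  · rintro ⟨j, c, C⟩ h
    simp only [Finset.mem_sigma, Finset.mem_range, Finset.mem_product, mem_cycles,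
      mem_multicyclesOfLength] at h
    simp only [Finset.mem_sigma, Multiset.mem_toFinset, mem_multicyclesOfLength,
      Multiset.mem_cons_self, and_true, sum_visits_cons]
    omega
  · rintro ⟨C, c⟩ h
    simp only [Finset.mem_sigma, Multiset.mem_toFinset] at h
    simp [Multiset.cons_erase h.2]
  · rintro ⟨j, c, C⟩ h
    simp only [Finset.mem_sigma, Finset.mem_product, mem_cycles] at h
    simp [h.2.1]
  · rintro ⟨C, c⟩ h
    simp only [Finset.mem_sigma, Multiset.mem_toFinset] at h
    obtain ⟨D, rfl⟩ := Multiset.exists_cons_of_mem h.2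
    have hlen : ((c.toCycle.length - 1 : ℕ) : MvPolynomial V ℂ) + 1 = (c.toCycle.length : ℕ) := by
      rw [← Nat.cast_add_one, Nat.sub_add_cancel c.length_pos]
    simp only [Multiset.erase_cons_head, Multiset.count_cons_self, hlen]
    rw [← multicycleTerm_cons, Nat.cast_mul]
    ring

/-- The coefficients of `det (1 - s B)`, for `B` the marked block matrix, are sums over multisets
of cycles. -/
theorem coeff_charpolyRev_markedBlockMatrix (k : ℕ) :
    (markedBlockMatrix x U).charpolyRev.coeff k =
      ∑ C ∈ multicyclesOfLength V k, multicycleTerm x U C := by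
  induction k using Nat.strong_induction_on with | _ k ih
  cases k with
  | zero =>
    have h0 : multicyclesOfLength V 0 = {0} := by
      ext C
      rw [mem_multicyclesOfLength, Finset.mem_singleton, sum_visits]
      constructor
      · intro h
        refine Multiset.eq_zero_of_forall_notMem fun c hc => c.length_pos.ne' ?_
        exact Multiset.sum_eq_zero_iff.1 h _ (Multiset.mem_map_of_mem _ hc)
      · rintro rfl
        simp
    have h1 : (Finsupp.equivFunOnFinite.symm (0 : V → ℕ)) = 0 := by ext; simp
    rw [Polynomial.coeff_zero_eq_eval_zero, Matrix.eval_charpolyRev, h0]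
    simp [multicycleTerm, multFactorial, visits, h1]
  | succ k =>
    -- In characteristic zero k + 1 cancels, so the common recursion determines the coefficients.
    have hk : ((k : MvPolynomial V ℂ) + 1) ≠ 0 := Nat.cast_add_one_ne_zero k
    refine mul_left_cancel₀ hk ?_
    rw [Matrix.coeff_charpolyRev_succ, sum_multicycleTerm_succ]
    refine congrArg Neg.neg (Finset.sum_congr rfl fun j _ => ?_)
    rw [ih (k - j) (by omega)]

end QuiverRep

/-! ### Truncation by degree and specialization of the variables -/

namespace QuiverRep

open MvPolynomial

universe u w

variable {V : Type u} [Quiver.{w} V] [Fintype V] [DecidableEq V] [∀ a b : V, Fintype (a ⟶ b)]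
  {n : V → ℕ} (x : Edge V → ℂ) (U : ∀ e : Edge V, Matrix (Fin (n e.src)) (Fin (n e.tgt)) ℂ)

/-- The variable of `a` occurs only in the `n a` rows at `a`, and linearly. -/
theorem degreeOf_det_one_sub_markedBlockMatrix_le (a : V) :
    degreeOf a (1 - markedBlockMatrix x U).det ≤ n a := by
  refine (degreeOf_det_le _ a (fun i => if i.1 = a then 1 else 0) fun i j => ?_).trans ?_
  · have h1 : degreeOf a ((1 : Matrix (Σ v, Fin (n v)) (Σ v, Fin (n v)) (MvPolynomial V ℂ)) i j)
        = 0 := by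
      rw [Matrix.one_apply]
      split_ifs
      · exact degreeOf_one a
      · exact degreeOf_zero a
    have h2 : degreeOf a (markedBlockMatrix x U i j) ≤ if i.1 = a then 1 else 0 := by
      by_cases h0 : blockMatrix x U i j = 0
      · simp [markedBlockMatrix, h0]
      · rw [markedBlockMatrix, degreeOf_monomial_eq _ _ h0, Finsupp.single_apply]
    refine (degreeOf_sub_le a _ _).trans ?_
    rw [h1]
    exact max_le (Nat.zero_le _) h2
  · rw [Fintype.sum_sigma, Finset.sum_eq_single_of_mem a (Finset.mem_univ a)]
    · simp
    · intro b _ hb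
      simp [hb]

/-- The power of s is the total length, which the exponent `v` already fixes; so at s = 1 a single
coefficient contributes. -/
theorem coeff_det_one_sub_markedBlockMatrix (v : V →₀ ℕ) :
    coeff v (1 - markedBlockMatrix x U).det =
      ∑ C ∈ multicyclesOfLength V (∑ a, v a), coeff v (multicycleTerm x U C) := by
  have h1 : (1 - markedBlockMatrix x U).det = (markedBlockMatrix x U).charpolyRev.eval 1 := by
    rw [Matrix.charpolyRev, ← Polynomial.coe_evalRingHom, RingHom.map_det]
    congr 1
    ext i j : 2
    by_cases h : i = j <;> simp [h]
  set K := max (markedBlockMatrix x U).charpolyRev.natDegree (∑ a, v a) + 1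
  rw [h1, Polynomial.eval_eq_sum_range' (n := K) (by omega), coeff_sum]
  simp only [one_pow, mul_one, coeff_charpolyRev_markedBlockMatrix, coeff_sum]
  refine Finset.sum_eq_single_of_mem _ (Finset.mem_range.2 (by omega)) fun k _ hk => ?_
  refine Finset.sum_eq_zero fun C hC => ?_
  rw [coeff_multicycleTerm, if_neg]
  intro h
  rw [mem_multicyclesOfLength, h] at hC
  exact hk hC.symm

theorem det_one_sub_markedBlockMatrix :
    (1 - markedBlockMatrix x U).det = ∑ C ∈ multicycles n, multicycleTerm x U C := by
  ext v
  rw [coeff_sum]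
  by_cases hv : ⇑v ≤ n
  · rw [coeff_det_one_sub_markedBlockMatrix]
    simp only [coeff_multicycleTerm, ← Finset.sum_filter]
    refine Finset.sum_congr ?_ fun _ _ => rfl
    ext C
    simp only [Finset.mem_filter, mem_multicyclesOfLength, mem_multicycles]
    constructor
    · rintro ⟨_, h⟩
      exact ⟨h ▸ hv, h⟩
    · rintro ⟨_, h⟩
      exact ⟨by rw [h], h⟩
  -- For `v` not below `n`, individual multisets may have nonzero terms; the degree bound forces
  -- them to cancel in total.
  · rw [Finset.sum_eq_zero fun C hC => ?_]
    · by_contra h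
      exact hv fun a => (monomial_le_degreeOf a (mem_support_iff.2 h)).trans
        (degreeOf_det_one_sub_markedBlockMatrix_le x U a)
    · rw [coeff_multicycleTerm, if_neg]
      rintro h
      exact hv (h ▸ mem_multicycles.1 hC)

/-- Factor out diag(w) and set each variable to 1 / w_a; v(C) ≤ n turns w^n w^(-v(C)) into a genuine
power. -/
theorem det_diagonal_sub_blockMatrix_of_ne_zero (w : V → ℂ) (hw : ∀ a, w a ≠ 0) :
    (Matrix.diagonal (fun i : Σ v, Fin (n v) => w i.1) - blockMatrix x U).det =
      ∑ C ∈ multicycles n, (∏ a, w a ^ (n a - visits C a)) *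
        ((C.map (Cyc.factor x U)).prod / (multFactorial C : ℂ)) := by
  have h1 : Matrix.diagonal (fun i : Σ v, Fin (n v) => w i.1) - blockMatrix x U =
      Matrix.diagonal (fun i : Σ v, Fin (n v) => w i.1) *
        (1 - markedBlockMatrix x U).map (eval fun a => (w a)⁻¹) := by
    ext i j
    rw [Matrix.diagonal_mul, Matrix.map_apply, Matrix.sub_apply, Matrix.sub_apply, map_sub,
      markedBlockMatrix, eval_monomial]
    by_cases h : i = j
    · subst h
      have := hw i.1
      simp
      field_simp
    · have := hw i.1
      simp [h]
      field_simp
  have h2 : ((1 - markedBlockMatrix x U).map (eval fun a => (w a)⁻¹)).det =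
      eval (fun a => (w a)⁻¹) (1 - markedBlockMatrix x U).det :=
    (RingHom.map_det (eval fun a => (w a)⁻¹) _).symm
  rw [h1, Matrix.det_mul, Matrix.det_diagonal, h2, det_one_sub_markedBlockMatrix, map_sum,
    Finset.mul_sum, Fintype.prod_sigma]
  refine Finset.sum_congr rfl fun C hC => ?_
  rw [multicycleTerm, eval_monomial, Finsupp.prod_fintype _ _ (by simp), mul_left_comm, mul_comm,
    ← Finset.prod_mul_distrib]
  congr 1
  refine Finset.prod_congr rfl fun a _ => ?_
  rw [pow_sub₀ _ (hw a) (mem_multicycles.1 hC a)]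
  simp

/-- Needed because t_a + z_a may vanish. Both sides are continuous in `w`, and vectors without zero
entries are dense. -/
theorem det_diagonal_sub_blockMatrix (w : V → ℂ) :
    (Matrix.diagonal (fun i : Σ v, Fin (n v) => w i.1) - blockMatrix x U).det =
      ∑ C ∈ multicycles n, (∏ a, w a ^ (n a - visits C a)) *
        ((C.map (Cyc.factor x U)).prod / (multFactorial C : ℂ)) := by
  have hdense : Dense {w : V → ℂ | ∀ a, w a ≠ 0} := by
    have := dense_pi (Set.univ : Set V) (s := fun _ => ({0}ᶜ : Set ℂ))
      fun _ _ => dense_compl_singleton 0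
    refine this.mono fun w hw a => ?_
    simpa using hw a (Set.mem_univ a)
  refine congrFun (Continuous.ext_on hdense ?_ ?_ fun w hw =>
    det_diagonal_sub_blockMatrix_of_ne_zero x U w hw) w
  · refine Continuous.matrix_det (Continuous.sub (Continuous.matrix_diagonal ?_) continuous_const)
    fun_prop
  · fun_prop

/-- In the standard basis, the terms x_e f(s(e)) add up to z_a on the diagonal and the terms x_e U_e
f(t(e)) to the block matrix. -/
theorem det_scalarDiag_add_laplacian (t : V → ℂ) :
    LinearMap.det (scalarDiag n t + laplacian x U) =
      ∑ C ∈ multicycles n, (∏ a, (t a + outWeight x a) ^ (n a - visits C a)) *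
        ((C.map (Cyc.factor x U)).prod / (multFactorial C : ℂ)) := by
  rw [← det_diagonal_sub_blockMatrix x U (fun a => t a + outWeight x a),
    ← LinearMap.det_toMatrix (Pi.basis fun v => Pi.basisFun ℂ (Fin (n v)))]
  congr 1
  ext ⟨a, i⟩ ⟨b, j⟩
  rw [LinearMap.toMatrix_apply, Pi.basis_repr, Pi.basis_apply, Pi.basisFun_apply,
    Pi.basisFun_repr]
  have h1 : ∀ c, c ≠ b → (Pi.single b (Pi.single j 1) : ∀ v, Fin (n v) → ℂ) c = 0 :=
    fun c hc => Pi.single_eq_of_ne hc _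
  have h2 : ∑ c, ∑ e : a ⟶ c, x ⟨a, c, e⟩ •
      (U ⟨a, c, e⟩ *ᵥ (Pi.single b (Pi.single j 1) : ∀ v, Fin (n v) → ℂ) c) i =
        blockMatrix x U ⟨a, i⟩ ⟨b, j⟩ := by
    rw [Finset.sum_eq_single_of_mem b (Finset.mem_univ b) fun c _ hc => by simp [h1 c hc]]
    simp [blockMatrix]
  have h3 : (Pi.single b (Pi.single j 1) : ∀ v, Fin (n v) → ℂ) a i =
      (1 : Matrix (Σ v, Fin (n v)) (Σ v, Fin (n v)) ℂ) ⟨a, i⟩ ⟨b, j⟩ := by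
    by_cases hab : a = b
    · subst hab
      simp [Matrix.one_apply, Pi.single_apply]
    · rw [h1 a hab, Matrix.one_apply_ne fun h => hab (congrArg Sigma.fst h)]
      rfl
  have h4 : (Matrix.diagonal fun i : Σ v, Fin (n v) => t i.1 + outWeight x i.1) ⟨a, i⟩ ⟨b, j⟩ =
      (t a + outWeight x a) *
        (1 : Matrix (Σ v, Fin (n v)) (Σ v, Fin (n v)) ℂ) ⟨a, i⟩ ⟨b, j⟩ := by
    rw [Matrix.diagonal_apply, Matrix.one_apply, mul_ite, mul_one, mul_zero]
  rw [Matrix.sub_apply, h4, ← h3, ← h2, outWeight]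
  simp only [LinearMap.add_apply, Pi.add_apply, scalarDiag, laplacian, LinearMap.coe_mk,
    AddHom.coe_mk, Finset.sum_apply, Pi.smul_apply, Pi.sub_apply, smul_sub, smul_eq_mul,
    Finset.sum_sub_distrib, add_mul, Finset.sum_mul]
  ring

end QuiverRep

/-! ### Binomial expansion in t -/

open QuiverRep in
theorem corollary5p3 {V : Type*} [Quiver V] [Fintype V] [DecidableEq V]
    [∀ a b : V, Fintype (a ⟶ b)]
    (no_loops : ∀ a : V, IsEmpty (a ⟶ a))
    (n : V → ℕ) (x : Edge V → ℂ)
    (U : ∀ e : Edge V, Matrix (Fin (n e.src)) (Fin (n e.tgt)) ℂ) :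
    (∀ t : V → ℂ,
      LinearMap.det (scalarDiag n t + laplacian x U) =
        ∑ k ∈ Finset.Icc 0 n, (∏ a, t a ^ k a) *
          ∑ C ∈ multicycles n with ∀ a, visits C a + k a ≤ n a,
            (∏ a, (((n a - visits C a).choose (k a) : ℕ) : ℂ)) *
            ((∏ a, outWeight x a ^ (n a - k a - visits C a)) / (multFactorial C : ℂ)) *
            (∏ e : Edge V, x e ^ edgeCount C e) *
            (C.map fun c => -c.traceHol U / (c.val : ℂ)).prod) ∧
    LinearMap.det (laplacian x U) =
      ∑ C ∈ multicycles n,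
        ((∏ a, outWeight x a ^ (n a - visits C a)) / (multFactorial C : ℂ)) *
        (C.map fun c => -(c.weight x * c.traceHol U) / (c.val : ℂ)).prod := by
  have hprod : ∀ C : Multiset (Cyc V), (∏ e : Edge V, x e ^ edgeCount C e) *
      (C.map fun c => -c.traceHol U / (c.val : ℂ)).prod = (C.map (Cyc.factor x U)).prod := by
    intro C
    rw [prod_pow_edgeCount, ← Multiset.prod_map_mul]
    refine congrArg Multiset.prod (Multiset.map_congr rfl fun c _ => ?_)
    rw [Cyc.factor]
    ring
  constructor
  · intro t
    rw [det_scalarDiag_add_laplacian]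
    simp only [Finset.mul_sum, Finset.sum_filter]
    rw [Finset.sum_comm]
    refine Finset.sum_congr rfl fun C hC => ?_
    have hC' : ∀ a, visits C a ≤ n a := mem_multicycles.1 hC
    simp only [add_pow, mul_ite, mul_zero]
    -- Expanding the product over vertices chooses a k_a ≤ n_a - v_a(C) for each a; as v(C) ≤ n,
    -- this is the condition v(C) + k ≤ n.
    rw [Finset.prod_univ_sum, Finset.sum_mul, ← Finset.sum_filter]
    refine Finset.sum_congr ?_ fun k hk => ?_
    · ext k
      simp only [Fintype.mem_piFinset, Finset.mem_range, Finset.mem_filter, Finset.mem_Icc,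
        Pi.le_def, zero_le, true_and]
      constructor
      · exact fun h => ⟨fun a => by have := h a; omega, fun a => by
          have := h a
          have := hC' a
          omega⟩
      · exact fun h a => by
          have := h.2 a
          omega
    · rw [← hprod, Finset.prod_mul_distrib, Finset.prod_mul_distrib]
      have : ∀ a, n a - k a - visits C a = n a - visits C a - k a := fun a => by omega
      simp only [this]
      ring
  -- At t = 0 the unexpanded formula applies directly, without isolating k = 0 in the sum.
  · have h0 : scalarDiag n (0 : V → ℂ) = 0 := by
      ext f a i
      simp [scalarDiag]
    rw [← zero_add (laplacian x U), ← h0, det_scalarDiag_add_laplacian]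
    refine Finset.sum_congr rfl fun C _ => ?_
    simp only [Pi.zero_apply, zero_add]
    have : (fun c => -(Cyc.weight x c * Cyc.traceHol U c) / (c.val : ℂ)) = Cyc.factor x U := rfl
    rw [this]
    ring
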